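/- A signed hypergraph $H=(V,S)$ consists of a finite set $V$ of nodes and a finite set $S$ of signed edges; a signed edge is a pair $s=(e,\eta_s)$ with $e\subseteq V$, $|e|\ge 2$, and $\eta_s:e\to\{-1,+1\}$ (different signed edges may have the same underlying edge $e$). We write $v\in s$ and $|s|$ for $v\in e$ and $|e|$, and for $v \in s$ with $|s|\ge 3$ let $s-v$ be the signed edge obtained by deleting $v$ and keeping the other signs. The pseudo-Boolean polytope $\mathrm{PBP}(H)\subseteq\mathbb R^{V\cup S}$ is the convex hull of all $z\in\{0,1\}^{V\cup S}$ with $z_s=\prod_{v\in s}\sigma_s(z_v)$ for all $s\in S$, where $\sigma_s(z_v)=z_v$ if $\eta_s(v)=+1$ and $\sigma_s(z_v)=1-z_v$ if $\eta_s(v)=-1$. For $v\in V$ let $S_v$ be the set of signed edges containing $v$ and $P_v=\{s-v: s\in S_v,\ |s|\ge 3\}$. We say that $H$ is pointed if there is a node $v\in V$ such that the underlying edges containing $v$ are totally ordered by inclusion, $V$ is the underlying edge of a signed edge of maximum cardinality in $S_v$, and $S=S_v\cup P_v$. Theorem. Let $H=(V,S)$ be a pointed signed hypergraph. Then $\mathrm{PBP}(H)$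 has an extended formulation with at most $2|V|(|S|+1)$ variables and at most $4(|S|(|V|-2)+|V|)$ inequalities in which all coefficients and right-hand side constants are $0,\pm1$. That is, there are integers $m,k\ge 0$ with $|V|+|S|+k\le 2|V|(|S|+1)$ and $m\le 4(|S|(|V|-2)+|V|)$, and a matrix $A$ with $m$ rows and columns indexed by the disjoint union of $V$, $S$ and $\{1,\dots,k\}$, and a vector $b\in\mathbb R^m$, all entries of $A$ and $b$ being in $\{0,1,-1\}$, such that $$\mathrm{PBP}(H)=\{z\in\mathbb R^{V\cup S}:\ \exists\, y\in\mathbb R^k,\ A(z,y)\le b\}.$$ -/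

import Mathlib

/-- A signed edge on the node set `V`: a pair `(e, η)` of a set `e ⊆ V` of cardinality at least two
and a map `η` that assigns to each node of `e` a sign in `{-1, +1} = ℤˣ`. Equality in this type is
being "identical": same underlying edge and same signs. -/
structure SignedEdge (V : Type*) where
  /-- the underlying edge -/
  edge : Finset V
  two_le_card : 2 ≤ edge.card
  /-- the sign of each node of the edge -/
  sign : {u : V // u ∈ edge} → ℤˣ

/-- A signed hypergraph with (finite) node set `V`: a finite set of signed edges. Parallel signed
edges are allowed, identical ones are not. -/
structure SignedHypergraph (V : Type*) where
  /-- the set `S` of signed edges -/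
  edges : Finset (SignedEdge V)

namespace SignedEdge

/-- The signed edge `s - v`: the node `v` is deleted and the signs of the remaining nodes are kept.
The hypothesis ensures that what remains has at least two nodes. -/
def remove {V : Type*} [DecidableEq V] (s : SignedEdge V) (v : V) (h : 3 ≤ s.edge.card) :
    SignedEdge V where
  edge := s.edge.erase v
  two_le_card := by
    have := Finset.pred_card_le_card_erase (s := s.edge) (a := v)
    omega
  sign := fun u => s.sign ⟨u.1, Finset.mem_of_mem_erase u.2⟩

end SignedEdge

/-- A node `v` is a `β`-leaf of the hypergraph with edge set `E` if the set of edges that contain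
`v` is totally ordered by inclusion. -/
def IsBetaLeaf {V : Type*} (E : Set (Finset V)) (v : V) : Prop :=
  IsChain (· ⊆ ·) {e : Finset V | e ∈ E ∧ v ∈ e}

/-- `literal η x` is `x` if the sign `η` is `+1` and `1 - x` if it is `-1`. -/
def literal (η : ℤˣ) (x : ℝ) : ℝ :=
  if η = 1 then x else 1 - x

namespace SignedHypergraph

/-- The edge set of the underlying hypergraph: signs are ignored, parallel edges are merged. -/
def underlyingEdges {V : Type*} (H : SignedHypergraph V) : Set (Finset V) :=
  {e | ∃ s ∈ H.edges, s.edge = e}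

/-- `S_v`: the signed edges that contain `v`. -/
def star {V : Type*} (H : SignedHypergraph V) (v : V) : Set (SignedEdge V) :=
  {s | s ∈ H.edges ∧ v ∈ s.edge}

/-- `P_v = {s - v : s ∈ S_v, |s| ≥ 3}`. -/
def reducedStar {V : Type*} [DecidableEq V] (H : SignedHypergraph V) (v : V) :
    Set (SignedEdge V) :=
  {p | ∃ s ∈ H.star v, ∃ h : 3 ≤ s.edge.card, p = s.remove v h}

/-- `H` is pointed at `v`: `v` is a `β`-leaf of the underlying hypergraph, the node set is the
underlying edge of a signed edge of maximum cardinality in `S_v`, and `S = S_v ∪ P_v`. -/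
def IsPointedAt {V : Type*} [Fintype V] [DecidableEq V] (H : SignedHypergraph V) (v : V) : Prop :=
  IsBetaLeaf H.underlyingEdges v ∧
  (∃ s ∈ H.star v, (∀ t ∈ H.star v, t.edge.card ≤ s.edge.card) ∧ s.edge = Finset.univ) ∧
  (H.edges : Set (SignedEdge V)) = H.star v ∪ H.reducedStar v

/-- `H` is a pointed signed hypergraph. -/
def IsPointed {V : Type*} [Fintype V] [DecidableEq V] (H : SignedHypergraph V) : Prop :=
  ∃ v : V, H.IsPointedAt v

/-- The index set `V ∪ S` of the coordinates: one per node and one per signed edge. -/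
abbrev Coord {V : Type*} (H : SignedHypergraph V) : Type _ :=
  V ⊕ {s : SignedEdge V // s ∈ H.edges}

/-- The pseudo-Boolean set: all `z ∈ {0,1}^(V ∪ S)` with `z_s = ∏_{v ∈ s} σ_s(z_v)` for every
signed edge `s`. -/
def pseudoBooleanSet {V : Type*} (H : SignedHypergraph V) : Set (H.Coord → ℝ) :=
  {z | (∀ i, z i = 0 ∨ z i = 1) ∧
    ∀ s : {s : SignedEdge V // s ∈ H.edges},
      z (Sum.inr s) = ∏ v : {u : V // u ∈ s.1.edge}, literal (s.1.sign v) (z (Sum.inl v.1))}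

/-- The pseudo-Boolean polytope: the convex hull of the pseudo-Boolean set. -/
def pseudoBooleanPolytope {V : Type*} (H : SignedHypergraph V) : Set (H.Coord → ℝ) :=
  convexHull ℝ H.pseudoBooleanSet

end SignedHypergraph

/-- The system `A (z, y) ≤ b` of `m` linear inequalities in the original variables `z` and `k`
additional variables `y` is an extended formulation of `P`: its solution set projects onto `P`. -/
def IsExtendedFormulation {ι : Type*} [Fintype ι] {m k : ℕ} (P : Set (ι → ℝ))
    (A : Matrix (Fin m) (ι ⊕ Fin k) ℝ) (b : Fin m → ℝ) : Prop :=
  P = {z | ∃ y : Fin k → ℝ, A.mulVec (Sum.elim z y) ≤ b}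

/-!
Let `v` be the node at which `H` is pointed and `n = |V|`. Since `v` is a `β`-leaf, the nodes can be
ordered, starting with `v`, so that every edge at `v` is an initial segment
(`IsBetaLeaf.exists_order`). A signed edge at `v` then prescribes the value of `z_v` and a word of
bits for the nodes that follow, and `s - v` prescribes just the word. A `0/1` point is a bit `c` for
`v` together with a walk down the binary trie of these words, which at some moment leaves the trie
and from then on influences only the node variables. Letting `flow b c` be the indicator of "the
walk passes `b` and `z_v = c`", the variable of a signed edge at `v` is a flow variable, and that of
`s - v` is the sum of two flow variables.

In the convex hull these variables form a unit flow of two commodities in the trie, and in addition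
each node variable is at least the flow on the arcs of its level with label `1`, and its complement
at least the flow on those with label `0`. Conversely these conditions suffice
(`IsTrieFlow.sum_wordWeight_indicator`, `IsTrieFlow.sum_wordWeight_bit`): choose a random word by
following the flow inside the trie, and after leaving it draw the remaining bits independently, with
the probabilities that produce the prescribed node variables. This exhibits every solution as a
convex combination of integral points (`projectedSolutions_trieSystem`).

For the counts let `P` be the set of words of the edges `s - v`, all of length between `2` and
`n - 1`. The trie has at most `|P| (n - 2) + 1` inner nodes (`card_innerNodes_le`), each with four
outgoing flow variables, and `2 |P| ≤ |S|`. With flow conservation written economically, by three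
inequalities for the two equations at a node, the system has at most seven inequalities per inner
node and `|P| + 2 (n - 2) + 1` others (`card_trieSystem_le`), which is within the bound.
-/

/-! ### Linear systems with coefficients `0, ±1` -/

/-- The linear inequality `∑ i ∈ pos, w i - ∑ i ∈ neg, w i ≤ rhs`. Its coefficients are `0, ±1`,
whether or not `pos` and `neg` are disjoint. -/
structure SignConstraint (B : Type*) where
  /-- the variables entering with `+1` -/
  pos : Finset B
  /-- the variables entering with `-1` -/
  neg : Finset B
  /-- the right-hand side -/
  rhs : SignType

/-- `w` satisfies the inequality `r`. -/
def SignConstraint.Holds {B : Type*} (r : SignConstraint B) (w : B → ℝ) : Prop :=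
  ∑ i ∈ r.pos, w i - ∑ i ∈ r.neg, w i ≤ (r.rhs : ℝ)

/-- The vectors indexed by `ι` that extend, along `g : ι → B`, to a solution of the system `C`. -/
def projectedSolutions {ι B : Type*} (g : ι → B) (C : Finset (SignConstraint B)) : Set (ι → ℝ) :=
  {z | ∃ w : B → ℝ, (∀ i, w (g i) = z i) ∧ ∀ r ∈ C, r.Holds w}

theorem convex_projectedSolutions {ι B : Type*} (g : ι → B) (C : Finset (SignConstraint B)) :
    Convex ℝ (projectedSolutions g C) := by
  rintro z ⟨w, hw, hC⟩ z' ⟨w', hw', hC'⟩ s t hs ht hst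
  refine ⟨s • w + t • w', fun i => by simp [hw, hw'], fun r hr => ?_⟩
  have h1 := mul_le_mul_of_nonneg_left (hC r hr) hs
  have h2 := mul_le_mul_of_nonneg_left (hC' r hr) ht
  have h3 : s * (r.rhs : ℝ) + t * (r.rhs : ℝ) = (r.rhs : ℝ) := by rw [← add_mul, hst, one_mul]
  simp only [SignConstraint.Holds, Pi.add_apply, Pi.smul_apply, smul_eq_mul,
    Finset.sum_add_distrib, ← Finset.mul_sum] at *
  linarith

/-- A system over the variables `J`, some of which are named by `g`, is an extended formulation
of the projection of its solution set: the variables that `g` misses are the additional ones. -/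
theorem exists_isExtendedFormulation {ι B : Type*} [Fintype ι] [DecidableEq B] (g : ι → B)
    (hg : Function.Injective g) (J : Finset B) (hgJ : ∀ i, g i ∈ J)
    (C : Finset (SignConstraint B)) (hC : ∀ r ∈ C, r.pos ⊆ J ∧ r.neg ⊆ J) :
    ∃ (k : ℕ) (A : Matrix (Fin C.card) (ι ⊕ Fin k) ℝ) (b : Fin C.card → ℝ),
      IsExtendedFormulation (projectedSolutions g C) A b ∧ Fintype.card ι + k = J.card ∧
      (∀ i j, A i j = 0 ∨ A i j = 1 ∨ A i j = -1) ∧ (∀ i, b i = 0 ∨ b i = 1 ∨ b i = -1) := by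
  classical
  set G : Finset B := Finset.univ.image g with hG
  have hGJ : G ⊆ J := by
    intro x hx
    obtain ⟨i, -, rfl⟩ := Finset.mem_image.mp hx
    exact hgJ i
  have hGc : G.card = Fintype.card ι := by
    rw [hG, Finset.card_image_of_injective _ hg, Finset.card_univ]
  have hcard : Fintype.card ι + (J \ G).card = J.card := by
    rw [← hGc, add_comm, Finset.card_sdiff_add_card_eq_card hGJ]
  let e := (J \ G).equivFin
  let h : ι ⊕ Fin (J \ G).card → B := Sum.elim g (fun j => (e.symm j).1)
  have hh : Function.Injective h := by
    refine Function.Injective.sumElim hg (Subtype.val_injective.comp e.symm.injective) ?_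
    intro i j hij
    refine (Finset.mem_sdiff.mp (e.symm j).2).2 ?_
    rw [← hij]
    exact Finset.mem_image_of_mem _ (Finset.mem_univ _)
  have hJ : J = Finset.univ.image h := by
    ext x
    constructor
    · intro hx
      by_cases hxG : x ∈ G
      · obtain ⟨i, -, rfl⟩ := Finset.mem_image.mp hxG
        exact Finset.mem_image.mpr ⟨Sum.inl i, Finset.mem_univ _, rfl⟩
      · refine Finset.mem_image.mpr ⟨Sum.inr (e ⟨x, Finset.mem_sdiff.mpr ⟨hx, hxG⟩⟩),
          Finset.mem_univ _, ?_⟩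
        simp [h]
    · intro hx
      obtain ⟨i, -, rfl⟩ := Finset.mem_image.mp hx
      rcases i with i | j
      · exact hgJ i
      · exact (Finset.mem_sdiff.mp (e.symm j).2).1
  have hsum : ∀ (s : Finset B), s ⊆ J → ∀ w : B → ℝ,
      ∑ j, (if h j ∈ s then (1 : ℝ) else 0) * w (h j) = ∑ i ∈ s, w i := by
    intro s hs w
    have h1 : ∑ j, (if h j ∈ s then (1 : ℝ) else 0) * w (h j)
        = ∑ x ∈ J, (if x ∈ s then (1 : ℝ) else 0) * w x := by
      rw [← Finset.sum_image (f := fun x => (if x ∈ s then (1 : ℝ) else 0) * w x)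
        (fun _ _ _ _ hab => hh hab), ← hJ]
    rw [h1]
    simp only [ite_mul, one_mul, zero_mul]
    rw [← Finset.sum_filter, Finset.filter_mem_eq_inter, Finset.inter_eq_right.mpr hs]
  let c := C.equivFin
  let A : Matrix (Fin C.card) (ι ⊕ Fin (J \ G).card) ℝ := fun i j =>
    (if h j ∈ (c.symm i).1.pos then (1 : ℝ) else 0) - (if h j ∈ (c.symm i).1.neg then 1 else 0)
  have hrow : ∀ (i : Fin C.card) (w : B → ℝ), A.mulVec (fun j => w (h j)) i
      = ∑ x ∈ (c.symm i).1.pos, w x - ∑ x ∈ (c.symm i).1.neg, w x := by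
    intro i w
    rw [← hsum _ (hC _ (c.symm i).2).1 w, ← hsum _ (hC _ (c.symm i).2).2 w,
      ← Finset.sum_sub_distrib]
    simp only [Matrix.mulVec, dotProduct, A, sub_mul]
  refine ⟨(J \ G).card, A, fun i => ((c.symm i).1.rhs : ℝ), ?_, hcard, ?_, ?_⟩
  · ext z
    constructor
    · rintro ⟨w, hw, hC⟩
      refine ⟨fun j => w (e.symm j).1, fun i => ?_⟩
      have hv : Sum.elim z (fun j => w (e.symm j).1) = fun j => w (h j) := by
        funext j
        rcases j with i | j
        · exact (hw i).symm
        · rfl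
      rw [hv, hrow]
      exact hC _ (c.symm i).2
    · rintro ⟨y, hy⟩
      have hv : (fun j => Function.extend h (Sum.elim z y) 0 (h j)) = Sum.elim z y := by
        funext j
        exact hh.extend_apply _ _ _
      refine ⟨Function.extend h (Sum.elim z y) 0, fun i => congrFun hv (Sum.inl i),
        fun r hr => ?_⟩
      have h1 := hy (c ⟨r, hr⟩)
      rw [← hv, hrow] at h1
      simpa [SignConstraint.Holds] using h1
  · intro i j
    simp only [A]
    split_ifs <;> simp
  · intro i
    dsimp only
    rcases (c.symm i).1.rhs.trichotomy with h1 | h1 | h1 <;> simp [h1]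

/-! ### Words and unit flows on binary tries -/

/-- The first `i` bits of `f`, latest bit first, so that the prefixes of a bit sequence are the
suffixes of its words. -/
def word (f : ℕ → Bool) : ℕ → List Bool
  | 0 => []
  | i + 1 => f i :: word f i

theorem word_succ (f : ℕ → Bool) (i : ℕ) : word f (i + 1) = f i :: word f i := rfl

@[simp] theorem length_word (f : ℕ → Bool) (i : ℕ) : (word f i).length = i := by
  induction i with
  | zero => rfl
  | succ i ih => simp [word_succ, ih]

theorem word_eq_word_iff {f g : ℕ → Bool} {i : ℕ} :
    word f i = word g i ↔ ∀ j < i, f j = g j := by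
  induction i with
  | zero => simp [word]
  | succ i ih =>
    simp only [word_succ, List.cons.injEq, ih, Nat.lt_succ_iff_lt_or_eq]
    grind

/-- The bit sequence whose word of length `a.length` is `a`, continued by `false`. -/
def bits : List Bool → ℕ → Bool
  | [], _ => false
  | σ :: a, i => if i = a.length then σ else bits a i

theorem word_bits_cons (σ : Bool) (a : List Bool) {i : ℕ} (hi : i ≤ a.length) :
    word (bits (σ :: a)) i = word (bits a) i := by
  rw [word_eq_word_iff]
  intro j hj
  simp [bits, (show j ≠ a.length by omega)]

theorem word_bits_length (a : List Bool) : word (bits a) a.length = a := by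
  induction a with
  | nil => rfl
  | cons σ a ih =>
    rw [List.length_cons, word_succ, word_bits_cons σ a le_rfl, ih]
    simp [bits]

/-- The set of all words of length `i`. -/
def words : ℕ → Finset (List Bool)
  | 0 => {[]}
  | i + 1 => (words i).image (true :: ·) ∪ (words i).image (false :: ·)

theorem mem_words {i : ℕ} {a : List Bool} : a ∈ words i ↔ a.length = i := by
  induction i generalizing a with
  | zero => simp [words]
  | succ i ih =>
    rcases a with _ | ⟨_ | _, a⟩ <;> simp [words, ih]

theorem sum_words_succ (i : ℕ) (g : List Bool → ℝ) :
    ∑ a ∈ words (i + 1), g a = ∑ a ∈ words i, (g (true :: a) + g (false :: a)) := by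
  have hd : Disjoint ((words i).image (true :: ·)) ((words i).image (false :: ·)) := by
    rw [Finset.disjoint_left]
    intro a ha hb
    obtain ⟨b, -, rfl⟩ := Finset.mem_image.mp ha
    simp at hb
  rw [words, Finset.sum_union hd, Finset.sum_image (by simp), Finset.sum_image (by simp),
    Finset.sum_add_distrib]

/-- The total amount carried by the arcs with label `σ` that leave the nodes of depth `i`. -/
noncomputable def levelFlow (I : Finset (List Bool)) (y : List Bool → Bool → ℝ) (i : ℕ)
    (σ : Bool) : ℝ :=
  ∑ a ∈ I with a.length = i, (y (σ :: a) true + y (σ :: a) false)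

/-- A unit flow of two commodities in the binary trie with inner nodes `I`: `y b c` is the amount
of commodity `c` that reaches the node `b`. The numbers `x i` are compatible with it as
probabilities that the `i`-th bit is `true`: the flow fixes this bit only at the nodes of `I`. -/
structure IsTrieFlow (I : Finset (List Bool)) (N : ℕ) (x : ℕ → ℝ) (y : List Bool → Bool → ℝ) :
    Prop where
  unit : y [] true + y [] false = 1
  nonneg : ∀ a ∈ I, ∀ σ c, 0 ≤ y (σ :: a) c
  conserve : ∀ a ∈ I, ∀ c, y (true :: a) c + y (false :: a) c = y a c
  lower : ∀ i < N, levelFlow I y i true ≤ x i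
  upper : ∀ i < N, x i + levelFlow I y i false ≤ 1

/-- The probability of the bit `true` in position `i` for a word that has left the trie. It is
chosen so that the total probability of the `i`-th bit being `true` is `x i`. -/
noncomputable def offTrieProb (I : Finset (List Bool)) (x : ℕ → ℝ) (y : List Bool → Bool → ℝ)
    (i : ℕ) : ℝ :=
  (x i - levelFlow I y i true) / (1 - levelFlow I y i true - levelFlow I y i false)

/-- The weights of the words of all lengths: they follow the flow as long as the word stays in the
trie, afterwards the bits are drawn independently. -/
noncomputable def wordWeight (I : Finset (List Bool)) (x : ℕ → ℝ) (y : List Bool → Bool → ℝ)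
    (c : Bool) : List Bool → ℝ
  | [] => y [] c
  | σ :: a => if a ∈ I then y (σ :: a) c else
      wordWeight I x y c a *
        (if σ then offTrieProb I x y a.length else 1 - offTrieProb I x y a.length)

section TrieFlow

variable {I : Finset (List Bool)} {N : ℕ} {x : ℕ → ℝ} {y : List Bool → Bool → ℝ}

theorem wordWeight_eq (hI : ∀ σ a, σ :: a ∈ I → a ∈ I) {a : List Bool} (ha : a ∈ I) (c : Bool) :
    wordWeight I x y c a = y a c := by
  cases a with
  | nil => rfl
  | cons σ a => simp [wordWeight, hI σ a ha]

theorem IsTrieFlow.offTrieProb_mem (h : IsTrieFlow I N x y) {i : ℕ} (hi : i < N) :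
    0 ≤ offTrieProb I x y i ∧ offTrieProb I x y i ≤ 1 := by
  have h1 := h.lower i hi
  have h2 := h.upper i hi
  exact ⟨div_nonneg (by linarith) (by linarith), div_le_one_of_le₀ (by linarith) (by linarith)⟩

theorem IsTrieFlow.wordWeight_nonneg (h : IsTrieFlow I N x y) (hnil : [] ∈ I) (c : Bool)
    (a : List Bool) (ha : a.length ≤ N) : 0 ≤ wordWeight I x y c a := by
  induction a with
  | nil =>
    rw [wordWeight, ← h.conserve [] hnil c]
    exact add_nonneg (h.nonneg _ hnil _ _) (h.nonneg _ hnil _ _)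
  | cons σ a ih =>
    rw [List.length_cons] at ha
    have hp := h.offTrieProb_mem (show a.length < N by omega)
    rw [wordWeight]
    split_ifs with h1 h2
    · exact h.nonneg a h1 σ c
    · exact mul_nonneg (ih (by omega)) hp.1
    · exact mul_nonneg (ih (by omega)) (by linarith)

theorem IsTrieFlow.wordWeight_add (h : IsTrieFlow I N x y) (hI : ∀ σ a, σ :: a ∈ I → a ∈ I)
    (c : Bool) (a : List Bool) :
    wordWeight I x y c (true :: a) + wordWeight I x y c (false :: a) = wordWeight I x y c a := by
  by_cases ha : a ∈ I
  · rw [wordWeight_eq hI ha, ← h.conserve a ha c]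
    simp [wordWeight, ha]
  · simp only [wordWeight, ha, if_false, if_true, Bool.false_eq_true]
    ring

/-- The weights of the words of length `M` induce the weights of the words of length `i ≤ M`. -/
theorem IsTrieFlow.sum_wordWeight_word (h : IsTrieFlow I N x y)
    (hI : ∀ σ a, σ :: a ∈ I → a ∈ I) (c : Bool) (g : List Bool → ℝ) {i M : ℕ} (hi : i ≤ M) :
    ∑ a ∈ words M, wordWeight I x y c a * g (word (bits a) i)
      = ∑ b ∈ words i, wordWeight I x y c b * g b := by
  induction M, hi using Nat.le_induction with
  | base =>
    refine Finset.sum_congr rfl fun a ha => ?_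
    rw [← mem_words.mp ha, word_bits_length]
  | succ M hi ih =>
    rw [sum_words_succ, ← ih]
    refine Finset.sum_congr rfl fun a ha => ?_
    rw [mem_words] at ha
    rw [word_bits_cons _ _ (by omega), word_bits_cons _ _ (by omega), ← add_mul,
      h.wordWeight_add hI]

theorem IsTrieFlow.sum_wordWeight_eq_one (h : IsTrieFlow I N x y)
    (hI : ∀ σ a, σ :: a ∈ I → a ∈ I) (M : ℕ) :
    ∑ a ∈ words M, (wordWeight I x y true a + wordWeight I x y false a) = 1 := by
  have key := fun c => h.sum_wordWeight_word hI c (fun _ => 1) (Nat.zero_le M)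
  simp only [mul_one] at key
  rw [Finset.sum_add_distrib, key, key, ← h.unit]
  simp [words, wordWeight]

theorem IsTrieFlow.sum_wordWeight_indicator (h : IsTrieFlow I N x y)
    (hI : ∀ σ a, σ :: a ∈ I → a ∈ I) (c : Bool) (b : List Bool) (hb : b.length ≤ N) :
    ∑ a ∈ words N, wordWeight I x y c a * (if word (bits a) b.length = b then 1 else 0)
      = wordWeight I x y c b := by
  rw [h.sum_wordWeight_word hI c (fun d => if d = b then 1 else 0) hb]
  simp [mem_words]

/-- The probability that the `i`-th bit is `true` is `x i`. -/
theorem IsTrieFlow.sum_wordWeight_bit (h : IsTrieFlow I N x y)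
    (hI : ∀ σ a, σ :: a ∈ I → a ∈ I) {i : ℕ} (hi : i < N) :
    ∑ a ∈ words N, (wordWeight I x y true a + wordWeight I x y false a)
      * (if bits a i = true then 1 else 0) = x i := by
  have hfil : (words i).filter (· ∈ I) = I.filter (fun a => a.length = i) := by
    ext a
    simp [mem_words, and_comm]
  -- the words of length `i` carry total weight `1`, those in the trie carry the two level flows
  have htot := h.sum_wordWeight_eq_one hI i
  rw [← Finset.sum_filter_add_sum_filter_not _ (· ∈ I), hfil] at htot
  have hin : ∑ a ∈ I with a.length = i, (wordWeight I x y true a + wordWeight I x y false a)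
      = levelFlow I y i true + levelFlow I y i false := by
    rw [levelFlow, levelFlow, ← Finset.sum_add_distrib]
    refine Finset.sum_congr rfl fun a ha => ?_
    have ha' := (Finset.mem_filter.mp ha).1
    rw [wordWeight_eq hI ha', wordWeight_eq hI ha', ← h.conserve a ha', ← h.conserve a ha']
    ring
  rw [hin] at htot
  have hmarg : ∀ c, ∑ a ∈ words N, wordWeight I x y c a * (if bits a i = true then 1 else 0)
      = ∑ a ∈ words i, wordWeight I x y c (true :: a) := by
    intro c
    have key := h.sum_wordWeight_word hI c (fun d => if d.head? = some true then 1 else 0)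
      (Nat.succ_le_of_lt hi)
    rw [sum_words_succ] at key
    simpa [word_succ] using key
  simp only [add_mul]
  rw [Finset.sum_add_distrib, hmarg, hmarg, ← Finset.sum_add_distrib,
    ← Finset.sum_filter_add_sum_filter_not _ (· ∈ I), hfil]
  have h1 : ∑ a ∈ I with a.length = i,
      (wordWeight I x y true (true :: a) + wordWeight I x y false (true :: a))
      = levelFlow I y i true := by
    refine Finset.sum_congr rfl fun a ha => ?_
    simp [wordWeight, (Finset.mem_filter.mp ha).1]
  have h2 : ∑ a ∈ words i with a ∉ I,
      (wordWeight I x y true (true :: a) + wordWeight I x y false (true :: a))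
      = (∑ a ∈ words i with a ∉ I, (wordWeight I x y true a + wordWeight I x y false a))
        * offTrieProb I x y i := by
    rw [Finset.sum_mul]
    refine Finset.sum_congr rfl fun a ha => ?_
    have ha' := Finset.mem_filter.mp ha
    rw [mem_words] at ha'
    simp only [wordWeight, ha'.2, ha'.1, if_false, if_true]
    ring
  have h3 := h.lower i hi
  have h4 := h.upper i hi
  rw [h1, h2, eq_sub_of_add_eq' htot, offTrieProb, ← sub_sub]
  by_cases hD : 1 - levelFlow I y i true - levelFlow I y i false = 0
  · rw [hD]
    linarith
  · rw [mul_div_cancel₀ _ hD]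
    ring

end TrieFlow

/-! ### The system of a set of patterns -/

/-- The inner nodes of the trie of the words in `P`: the empty word and all proper suffixes of
words in `P`. -/
def innerNodes (P : Finset (List Bool)) : Finset (List Bool) :=
  insert [] (P.biUnion fun p => (Finset.Ico 1 p.length).image (p.drop ·))

section InnerNodes

variable {P : Finset (List Bool)}

theorem nil_mem_innerNodes : [] ∈ innerNodes P := Finset.mem_insert_self _ _

theorem mem_innerNodes_of_drop {p : List Bool} (hp : p ∈ P) {j : ℕ} (hj : 1 ≤ j) :
    p.drop j ∈ innerNodes P := by
  by_cases h : j < p.length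
  · exact Finset.mem_insert_of_mem (Finset.mem_biUnion.mpr
      ⟨p, hp, Finset.mem_image_of_mem _ (Finset.mem_Ico.mpr ⟨hj, h⟩)⟩)
  · rw [List.drop_eq_nil_of_le (by omega)]
    exact nil_mem_innerNodes

theorem exists_drop_of_mem_innerNodes {a : List Bool} (ha : a ∈ innerNodes P) (hne : a ≠ []) :
    ∃ p ∈ P, ∃ j, 1 ≤ j ∧ p.drop j = a := by
  simp only [innerNodes, Finset.mem_insert, hne, Finset.mem_biUnion, Finset.mem_image,
    Finset.mem_Ico, false_or] at ha
  obtain ⟨p, hp, j, hj, rfl⟩ := ha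
  exact ⟨p, hp, j, hj.1, rfl⟩

theorem mem_innerNodes_of_cons {σ : Bool} {a : List Bool} (h : σ :: a ∈ innerNodes P) :
    a ∈ innerNodes P := by
  obtain ⟨p, hp, j, hj, hpj⟩ := exists_drop_of_mem_innerNodes h (by simp)
  have : a = p.drop (j + 1) := by rw [← List.tail_drop, hpj, List.tail_cons]
  rw [this]
  exact mem_innerNodes_of_drop hp (by omega)

theorem mem_innerNodes_of_cons_mem {σ : Bool} {a : List Bool} (h : σ :: a ∈ P) :
    a ∈ innerNodes P :=
  mem_innerNodes_of_drop h le_rfl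

theorem length_lt_of_mem_innerNodes {N : ℕ} (hN : 0 < N) (hP : ∀ p ∈ P, p.length ≤ N)
    {a : List Bool} (ha : a ∈ innerNodes P) : a.length < N := by
  by_cases hne : a = []
  · simpa [hne] using hN
  · obtain ⟨p, hp, j, hj, rfl⟩ := exists_drop_of_mem_innerNodes ha hne
    have := hP p hp
    rw [List.length_drop]
    omega

theorem card_innerNodes_le {N : ℕ} (hP : ∀ p ∈ P, p.length ≤ N) :
    (innerNodes P).card ≤ P.card * (N - 1) + 1 := by
  refine (Finset.card_insert_le _ _).trans (Nat.succ_le_succ ?_)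
  refine Finset.card_biUnion_le_card_mul _ _ _ fun p hp => Finset.card_image_le.trans ?_
  rw [Nat.card_Ico]
  have := hP p hp
  omega

end InnerNodes

/-- The variables of the formulation: `node i` for the `i`-th node of the hypergraph, `edge p` for
the edge with pattern `p`, and `flow b c` for the part of the points that pass through the node
`b` of the trie and have value `c` at the node `0`. -/
inductive TrieVar
  | node (i : ℕ)
  | edge (p : List Bool)
  | flow (b : List Bool) (c : Bool)
  deriving DecidableEq

open TrieVar in
/-- The variables that occur in the system of the pattern set `P` on the nodes `0, …, N`. -/
def trieVars (N : ℕ) (P : Finset (List Bool)) : Finset TrieVar :=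
  (Finset.range (N + 1)).image node ∪ P.image edge ∪
    (innerNodes P ×ˢ (Finset.univ : Finset (Bool × Bool))).image
      (fun q => flow (q.2.1 :: q.1) q.2.2)

section TrieVars

variable {N : ℕ} {P : Finset (List Bool)}

@[simp] theorem node_mem_trieVars {i : ℕ} : TrieVar.node i ∈ trieVars N P ↔ i ≤ N := by
  simp [trieVars]

@[simp] theorem edge_mem_trieVars {p : List Bool} : TrieVar.edge p ∈ trieVars N P ↔ p ∈ P := by
  simp [trieVars]

@[simp] theorem flow_nil_mem_trieVars {c : Bool} : TrieVar.flow [] c ∉ trieVars N P := by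
  simp [trieVars]

@[simp] theorem flow_cons_mem_trieVars {σ c : Bool} {a : List Bool} :
    TrieVar.flow (σ :: a) c ∈ trieVars N P ↔ a ∈ innerNodes P := by
  simp only [trieVars, Finset.mem_union, Finset.mem_image, Finset.mem_product, Finset.mem_univ,
    and_true, reduceCtorEq, and_false, exists_false, false_or, TrieVar.flow.injEq,
    List.cons.injEq, Prod.exists]
  constructor
  · rintro ⟨b, τ, d, hb, ⟨-, rfl⟩, -⟩
    exact hb
  · exact fun h => ⟨a, σ, c, h, ⟨rfl, rfl⟩, rfl⟩

theorem card_trieVars_le : (trieVars N P).card ≤ (N + 1) + P.card + 4 * (innerNodes P).card := by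
  refine (Finset.card_union_le _ _).trans (add_le_add ((Finset.card_union_le _ _).trans
    (add_le_add (Finset.card_image_le.trans (by simp)) Finset.card_image_le))
    (Finset.card_image_le.trans ?_))
  simp [Finset.card_product, mul_comm]

end TrieVars

open TrieVar in
/-- The variables whose sum is the total flow into `b`; `edge b` replaces the two flow variables
where it exists. -/
def outletVars (P : Finset (List Bool)) (b : List Bool) : Finset TrieVar :=
  if b ∈ P then {edge b} else {flow b true, flow b false}

open TrieVar in
/-- The flow variables of the arcs with label `σ` that leave the inner nodes of depth `i`. -/
def levelVars (P : Finset (List Bool)) (i : ℕ) (σ : Bool) : Finset TrieVar :=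
  (((innerNodes P).filter (fun a => a.length = i)) ×ˢ (Finset.univ : Finset Bool)).image
    (fun q => flow (σ :: q.1) q.2)

open Classical TrieVar in
/-- The system of the pattern set `P` on the nodes `0, …, N`. Flow conservation at a node is
written with one inequality for each of the two commodities and one converse inequality for their
sum; the link between `edge p` and the flow into `p` takes only one inequality more, because the
converse is absorbed by the conservation at the parent of `p`. At the root the two inequalities
that involve `node 1` serve as the converse. -/
noncomputable def trieSystem (N : ℕ) (P : Finset (List Bool)) : Finset (SignConstraint TrieVar) :=
  (innerNodes P ×ˢ (Finset.univ : Finset (Bool × Bool))).image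
      (fun q => ⟨∅, {flow (q.2.1 :: q.1) q.2.2}, 0⟩) ∪
  {⟨{flow [true] true, flow [false] true}, {node 0}, 0⟩,
    ⟨{flow [true] false, flow [false] false, node 0}, ∅, 1⟩} ∪
  ((innerNodes P).erase [] ×ˢ (Finset.univ : Finset Bool)).image
      (fun q => ⟨{flow (true :: q.1) q.2, flow (false :: q.1) q.2}, {flow q.1 q.2}, 0⟩) ∪
  ((innerNodes P).erase []).image
      (fun a => ⟨{flow a true, flow a false},
        outletVars P (true :: a) ∪ outletVars P (false :: a), 0⟩) ∪
  P.image (fun p => ⟨{edge p}, {flow p true, flow p false}, 0⟩) ∪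
  {⟨{node 1}, {flow [true] true, flow [true] false}, 0⟩,
    ⟨∅, {node 1, flow [false] true, flow [false] false}, -1⟩} ∪
  (Finset.Ico 1 N).image (fun i => ⟨levelVars P i true, {node (i + 1)}, 0⟩) ∪
  (Finset.Ico 1 N).image (fun i => ⟨insert (node (i + 1)) (levelVars P i false), ∅, 1⟩)

theorem card_trieSystem_le (N : ℕ) (P : Finset (List Bool)) :
    (trieSystem N P).card ≤ 7 * (innerNodes P).card + 1 + P.card + 2 * (N - 1) := by
  have he : ((innerNodes P).erase []).card + 1 = (innerNodes P).card :=
    Finset.card_erase_add_one nil_mem_innerNodes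
  have h : (trieSystem N P).card ≤ (innerNodes P).card * 4 + 2
      + ((innerNodes P).erase []).card * 2 + ((innerNodes P).erase []).card + P.card + 2
      + (N - 1) + (N - 1) := by
    classical
    unfold trieSystem
    repeat' refine (Finset.card_union_le _ _).trans (add_le_add ?_ ?_)
    · exact Finset.card_image_le.trans (by simp [Finset.card_product])
    · exact Finset.card_le_two
    · exact Finset.card_image_le.trans (by simp [Finset.card_product])
    · exact Finset.card_image_le
    · exact Finset.card_image_le
    · exact Finset.card_le_two
    · exact Finset.card_image_le.trans (by simp)
    · exact Finset.card_image_le.trans (by simp)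
  omega

theorem trieSystem_subset_trieVars {N : ℕ} {P : Finset (List Bool)} (hN : 0 < N)
    (hP : ∀ p ∈ P, 2 ≤ p.length) :
    ∀ r ∈ trieSystem N P, r.pos ⊆ trieVars N P ∧ r.neg ⊆ trieVars N P := by
  have hin : ∀ a ∈ innerNodes P, a ≠ [] → ∀ c, TrieVar.flow a c ∈ trieVars N P := by
    intro a ha hne c
    obtain ⟨σ, b, rfl⟩ := List.exists_cons_of_ne_nil hne
    exact flow_cons_mem_trieVars.mpr (mem_innerNodes_of_cons ha)
  have hinP : ∀ p ∈ P, ∀ c, TrieVar.flow p c ∈ trieVars N P := by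
    intro p hp c
    have := hP p hp
    obtain ⟨σ, b, rfl⟩ := List.exists_cons_of_ne_nil (show p ≠ [] by rintro rfl; simp at this)
    exact flow_cons_mem_trieVars.mpr (mem_innerNodes_of_cons_mem hp)
  have hout : ∀ a ∈ innerNodes P, ∀ σ, outletVars P (σ :: a) ⊆ trieVars N P := by
    intro a ha σ
    unfold outletVars
    split_ifs with h
    · simpa using h
    · simp [Finset.insert_subset_iff, ha]
  have hlev : ∀ i σ, levelVars P i σ ⊆ trieVars N P := by
    intro i σ v hv
    obtain ⟨q, hq, rfl⟩ := Finset.mem_image.mp hv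
    exact flow_cons_mem_trieVars.mpr (Finset.mem_filter.mp (Finset.mem_product.mp hq).1).1
  have hnil := nil_mem_innerNodes (P := P)
  simp only [trieSystem, Finset.forall_mem_union, Finset.forall_mem_image, Finset.mem_insert,
    Finset.mem_singleton, forall_eq_or_imp, forall_eq, Finset.mem_product, Finset.mem_erase,
    Finset.mem_univ, and_true, Finset.insert_subset_iff, Finset.singleton_subset_iff,
    Finset.empty_subset, true_and, Finset.union_subset_iff, flow_cons_mem_trieVars,
    node_mem_trieVars, edge_mem_trieVars, Finset.mem_Ico, hnil, Prod.forall]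
  refine ⟨⟨⟨⟨⟨⟨⟨?_, ?_⟩, ?_⟩, ?_⟩, ?_⟩, ?_⟩, ?_⟩, ?_⟩
  · exact fun a _ _ h => h
  · omega
  · exact fun a c h => ⟨⟨h.2, h.2⟩, hin a h.2 h.1 c⟩
  · exact fun a h => ⟨⟨hin a h.2 h.1 _, hin a h.2 h.1 _⟩, hout a h.2 _, hout a h.2 _⟩
  · exact fun p h => ⟨h, hinP p h _, hinP p h _⟩
  · omega
  · exact fun i h => ⟨hlev i _, by omega⟩
  · exact fun i h => ⟨by omega, hlev i _⟩

/-- The total flow into `b`, read from the variables `outletVars P b`. -/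
noncomputable def outletFlow (P : Finset (List Bool)) (w : TrieVar → ℝ) (b : List Bool) : ℝ :=
  if b ∈ P then w (.edge b) else w (.flow b true) + w (.flow b false)

/-- The amount of commodity `c` that reaches the node `b`. At the root it is given by the variable
of the node `0`. -/
noncomputable def nodeFlow (w : TrieVar → ℝ) : List Bool → Bool → ℝ
  | [], c => if c then w (.node 0) else 1 - w (.node 0)
  | σ :: a, c => w (.flow (σ :: a) c)

open TrieVar in
/-- The inequalities of `trieSystem N P`, written out. -/
structure IsTrieSolution (N : ℕ) (P : Finset (List Bool)) (w : TrieVar → ℝ) : Prop where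
  nonneg : ∀ a ∈ innerNodes P, ∀ σ c, 0 ≤ w (flow (σ :: a) c)
  root_true : w (flow [true] true) + w (flow [false] true) ≤ w (node 0)
  root_false : w (flow [true] false) + w (flow [false] false) + w (node 0) ≤ 1
  conserve : ∀ a ∈ innerNodes P, a ≠ [] → ∀ c,
    w (flow (true :: a) c) + w (flow (false :: a) c) ≤ w (flow a c)
  close : ∀ a ∈ innerNodes P, a ≠ [] → w (flow a true) + w (flow a false) ≤
    outletFlow P w (true :: a) + outletFlow P w (false :: a)
  link : ∀ p ∈ P, w (edge p) ≤ w (flow p true) + w (flow p false)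
  first_true : w (node 1) ≤ w (flow [true] true) + w (flow [true] false)
  first_false : 1 ≤ w (node 1) + w (flow [false] true) + w (flow [false] false)
  lower : ∀ i, 1 ≤ i → i < N → levelFlow (innerNodes P) (nodeFlow w) i true ≤ w (node (i + 1))
  upper : ∀ i, 1 ≤ i → i < N →
    w (node (i + 1)) + levelFlow (innerNodes P) (nodeFlow w) i false ≤ 1

section System

variable {N : ℕ} {P : Finset (List Bool)} {w : TrieVar → ℝ}

theorem sum_outletVars (b : List Bool) : ∑ v ∈ outletVars P b, w v = outletFlow P w b := by
  unfold outletVars outletFlow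
  split_ifs
  · simp
  · rw [Finset.sum_pair (by simp)]

theorem sum_outletVars_union (a : List Bool) :
    ∑ v ∈ outletVars P (true :: a) ∪ outletVars P (false :: a), w v
      = outletFlow P w (true :: a) + outletFlow P w (false :: a) := by
  rw [Finset.sum_union, sum_outletVars, sum_outletVars]
  unfold outletVars
  split_ifs <;> simp

theorem sum_levelVars (i : ℕ) (σ : Bool) :
    ∑ v ∈ levelVars P i σ, w v = levelFlow (innerNodes P) (nodeFlow w) i σ := by
  rw [levelVars, Finset.sum_image, Finset.sum_product, levelFlow]
  · simp [nodeFlow]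
  · rintro ⟨a, c⟩ - ⟨b, d⟩ - h
    simpa using h

theorem holds_trieSystem_iff : (∀ r ∈ trieSystem N P, r.Holds w) ↔ IsTrieSolution N P w := by
  have hnode : ∀ i, TrieVar.node (i + 1) ∉ levelVars P i false := by simp [levelVars]
  simp only [trieSystem, Finset.forall_mem_union, Finset.forall_mem_image, Finset.mem_insert,
    Finset.mem_singleton, forall_eq_or_imp, forall_eq, Finset.mem_product, Finset.mem_erase,
    Finset.mem_univ, and_true, Finset.mem_Ico, Prod.forall, SignConstraint.Holds,
    sum_outletVars_union, sum_levelVars, Finset.sum_insert (hnode _), Finset.sum_empty,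
    Finset.sum_singleton, SignType.coe_zero, SignType.coe_one, SignType.coe_neg_one]
  rw [Finset.sum_pair (by simp), Finset.sum_insert (by simp), Finset.sum_pair (by simp),
    Finset.sum_pair (by simp), Finset.sum_insert (by simp), Finset.sum_pair (by simp)]
  have hbit : ∀ {a : List Bool} {c : Bool},
      TrieVar.flow (true :: a) c ≠ TrieVar.flow (false :: a) c := by simp
  have hcom : ∀ {a : List Bool}, TrieVar.flow a true ≠ TrieVar.flow a false := by simp
  simp only [Finset.sum_pair hbit, Finset.sum_pair hcom]
  constructor
  · rintro ⟨⟨⟨⟨⟨⟨⟨h1, h2, h3⟩, h4⟩, h5⟩, h6⟩, h7, h8⟩, h9⟩, h10⟩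
    exact
      { nonneg := fun a ha σ c => by linarith [h1 a σ c ha]
        root_true := by linarith
        root_false := by linarith
        conserve := fun a ha hne c => by linarith [h4 a c ⟨hne, ha⟩]
        close := fun a ha hne => by linarith [h5 ⟨hne, ha⟩]
        link := fun p hp => by linarith [h6 hp]
        first_true := by linarith
        first_false := by linarith
        lower := fun i hi hN => by linarith [h9 ⟨hi, hN⟩]
        upper := fun i hi hN => by linarith [h10 ⟨hi, hN⟩] }
  · intro h
    refine ⟨⟨⟨⟨⟨⟨⟨?_, ?_, ?_⟩, ?_⟩, ?_⟩, ?_⟩, ?_, ?_⟩, ?_⟩, ?_⟩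
    · exact fun a σ c ha => by linarith [h.nonneg a ha σ c]
    · linarith [h.root_true]
    · linarith [h.root_false]
    · exact fun a c ha => by linarith [h.conserve a ha.2 ha.1 c]
    · exact fun a ha => by linarith [h.close a ha.2 ha.1]
    · exact fun p hp => by linarith [h.link p hp]
    · linarith [h.first_true]
    · linarith [h.first_false]
    · exact fun i hi => by linarith [h.lower i hi.1 hi.2]
    · exact fun i hi => by linarith [h.upper i hi.1 hi.2]

theorem levelFlow_zero (y : List Bool → Bool → ℝ) (σ : Bool) :
    levelFlow (innerNodes P) y 0 σ = y [σ] true + y [σ] false := by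
  have : (innerNodes P).filter (fun a => a.length = 0) = {[]} := by
    ext a
    simp only [Finset.mem_filter, List.length_eq_zero_iff, Finset.mem_singleton,
      and_iff_right_iff_imp]
    rintro rfl
    exact nil_mem_innerNodes
  rw [levelFlow, this, Finset.sum_singleton]

theorem IsTrieSolution.outletFlow_le (h : IsTrieSolution N P w) (b : List Bool) :
    outletFlow P w b ≤ w (.flow b true) + w (.flow b false) := by
  unfold outletFlow
  split_ifs with hb
  · exact h.link b hb
  · exact le_rfl

/-- The conservation at the parent of `p` absorbs the converse of the inequality linking `edge p` to
the flow into `p`. -/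
theorem IsTrieSolution.edge_eq (h : IsTrieSolution N P w) {p : List Bool} (hp : p ∈ P)
    (hlen : 2 ≤ p.length) : w (.edge p) = w (.flow p true) + w (.flow p false) := by
  obtain ⟨σ, a, rfl⟩ := List.exists_cons_of_ne_nil (show p ≠ [] by rintro rfl; simp at hlen)
  have ha := mem_innerNodes_of_cons_mem hp
  have hne : a ≠ [] := by rintro rfl; simp at hlen
  have h1 := h.conserve a ha hne true
  have h2 := h.conserve a ha hne false
  have h3 := h.close a ha hne
  have h4 := h.outletFlow_le (true :: a)
  have h5 := h.outletFlow_le (false :: a)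
  have h6 : outletFlow P w (σ :: a) = w (.edge (σ :: a)) := if_pos hp
  cases σ <;> linarith

theorem IsTrieSolution.isTrieFlow (h : IsTrieSolution N P w) :
    IsTrieFlow (innerNodes P) N (fun i => w (.node (i + 1))) (nodeFlow w) where
  unit := by simp [nodeFlow]
  nonneg := h.nonneg
  conserve := by
    have r1 := h.root_true
    have r2 := h.root_false
    have r3 := h.first_true
    have r4 := h.first_false
    rintro (_ | ⟨τ, a⟩) ha c
    · cases c <;> simp only [nodeFlow, if_true, Bool.false_eq_true, if_false] <;> linarith
    · have h1 := h.conserve _ ha (by simp) true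
      have h2 := h.conserve _ ha (by simp) false
      have h3 := h.close _ ha (by simp)
      have h4 := h.outletFlow_le (true :: τ :: a)
      have h5 := h.outletFlow_le (false :: τ :: a)
      cases c <;> simp only [nodeFlow] <;> linarith
  lower := by
    rintro (_ | i) hi
    · rw [levelFlow_zero]
      simp only [nodeFlow]
      linarith [h.root_true, h.root_false, h.first_true, h.first_false]
    · exact h.lower _ (by omega) hi
  upper := by
    rintro (_ | i) hi
    · rw [levelFlow_zero]
      simp only [nodeFlow]
      linarith [h.root_true, h.root_false, h.first_true, h.first_false]
    · exact h.upper _ (by omega) hi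

end System

/-! ### Integrality of the system -/

/-- The integral point of the bits `c` at the node `0` and `f i` at the node `i + 1`. -/
def triePoint (c : Bool) (f : ℕ → Bool) : TrieVar → ℝ
  | .node 0 => if c = true then 1 else 0
  | .node (i + 1) => if f i = true then 1 else 0
  | .edge p => if word f p.length = p then 1 else 0
  | .flow b d => if d = c then (if word f b.length = b then 1 else 0) else 0

theorem triePoint_flow_add (c : Bool) (f : ℕ → Bool) (b : List Bool) :
    triePoint c f (.flow b true) + triePoint c f (.flow b false)
      = if word f b.length = b then 1 else 0 := by
  cases c <;> simp [triePoint]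

theorem word_length_cons (f : ℕ → Bool) (σ : Bool) (a : List Bool) :
    word f (σ :: a).length = σ :: a ↔ f a.length = σ ∧ word f a.length = a := by
  simp [word_succ]

theorem levelFlow_triePoint_le (P : Finset (List Bool)) (c : Bool) (f : ℕ → Bool) (i : ℕ)
    (σ : Bool) : levelFlow (innerNodes P) (nodeFlow (triePoint c f)) i σ
      ≤ if f i = σ then 1 else 0 := by
  have h : levelFlow (innerNodes P) (nodeFlow (triePoint c f)) i σ
      = ∑ a ∈ innerNodes P with a.length = i,
        if word f i = a then (if f i = σ then (1 : ℝ) else 0) else 0 := by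
    refine Finset.sum_congr rfl fun a ha => ?_
    simp only [nodeFlow]
    rw [triePoint_flow_add, ← (Finset.mem_filter.mp ha).2]
    simp only [word_length_cons]
    split_ifs <;> simp_all
  rw [h, Finset.sum_ite_eq]
  split_ifs <;> norm_num

theorem isTrieSolution_triePoint (N : ℕ) (P : Finset (List Bool)) (c : Bool) (f : ℕ → Bool) :
    IsTrieSolution N P (triePoint c f) := by
  have hout : ∀ b, outletFlow P (triePoint c f) b = if word f b.length = b then 1 else 0 := by
    intro b
    unfold outletFlow
    by_cases hb : b ∈ P
    · rw [if_pos hb]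
      rfl
    · rw [if_neg hb, triePoint_flow_add]
  have hsplit : ∀ a : List Bool, (if word f (true :: a).length = true :: a then (1 : ℝ) else 0)
      + (if word f (false :: a).length = false :: a then 1 else 0)
      = if word f a.length = a then 1 else 0 := by
    intro a
    simp only [word_length_cons]
    cases f a.length <;> simp
  constructor
  · intro a _ σ d
    simp only [triePoint]
    split_ifs <;> norm_num
  · cases c <;> cases h : f 0 <;> simp [triePoint, word, h]
  · cases c <;> cases h : f 0 <;> simp [triePoint, word, h]
  · intro a _ _ d
    by_cases h : d = c
    · simp only [triePoint, h, if_true]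
      exact (hsplit a).le
    · simp [triePoint, h]
  · intro a _ _
    rw [hout, hout, hsplit, triePoint_flow_add]
  · intro p _
    rw [triePoint_flow_add]
    rfl
  · rw [triePoint_flow_add]
    cases h : f 0 <;> simp [triePoint, word, h]
  · rw [add_assoc, triePoint_flow_add]
    cases h : f 0 <;> simp [triePoint, word, h]
  · intro i _ _
    exact levelFlow_triePoint_le P c f i true
  · intro i _ _
    have := levelFlow_triePoint_le P c f i false
    simp only [triePoint]
    cases h : f i <;> simp [h] at this ⊢ <;> linarith

section Integrality

variable {N : ℕ} {P : Finset (List Bool)} {w : TrieVar → ℝ}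

/-- The weights decompose every variable of a solution into integral points. -/
theorem IsTrieSolution.eq_sum_triePoint (h : IsTrieSolution N P w) (hN : 0 < N)
    (hP : ∀ p ∈ P, 2 ≤ p.length ∧ p.length ≤ N) {v : TrieVar} (hv : v ∈ trieVars N P) :
    w v = ∑ q ∈ (Finset.univ : Finset Bool) ×ˢ words N,
      wordWeight (innerNodes P) (fun i => w (.node (i + 1))) (nodeFlow w) q.1 q.2
        * triePoint q.1 (bits q.2) v := by
  have hF := h.isTrieFlow
  have hI : ∀ σ a, σ :: a ∈ innerNodes P → a ∈ innerNodes P :=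
    fun _ _ => mem_innerNodes_of_cons
  have hlen := fun a (ha : a ∈ innerNodes P) =>
    length_lt_of_mem_innerNodes hN (fun p hp => (hP p hp).2) ha
  have hflow : ∀ σ a c, a ∈ innerNodes P →
      ∑ b ∈ words N, wordWeight (innerNodes P) (fun i => w (.node (i + 1))) (nodeFlow w) c b
        * (if word (bits b) (σ :: a).length = σ :: a then 1 else 0) = w (.flow (σ :: a) c) := by
    intro σ a c ha
    rw [hF.sum_wordWeight_indicator hI c (σ :: a) (hlen a ha), wordWeight, if_pos ha, nodeFlow]
  rw [Finset.sum_product, Fintype.sum_bool]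
  rcases v with (_ | i) | p | ⟨b, c⟩
  · have := hF.sum_wordWeight_word hI true (fun _ => 1) (Nat.zero_le N)
    simp only [mul_one] at this
    simp [triePoint, this, words, wordWeight, nodeFlow]
  · rw [node_mem_trieVars] at hv
    have := hF.sum_wordWeight_bit hI hv
    simp only [add_mul, Finset.sum_add_distrib] at this
    exact this.symm
  · rw [edge_mem_trieVars] at hv
    rw [h.edge_eq hv (hP p hv).1]
    obtain ⟨σ, a, rfl⟩ := List.exists_cons_of_ne_nil
      (show p ≠ [] by rintro rfl; simpa using (hP _ hv).1)
    have ha := mem_innerNodes_of_cons_mem hv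
    rw [← hflow σ a true ha, ← hflow σ a false ha]
    rfl
  · rcases b with _ | ⟨σ, a⟩
    · exact absurd hv flow_nil_mem_trieVars
    rw [flow_cons_mem_trieVars] at hv
    rw [← hflow σ a c hv]
    cases c <;> simp [triePoint]

/-- The projection of the solution set is the convex hull of the projections of the integral
points. -/
theorem projectedSolutions_trieSystem {ι : Type*} (g : ι → TrieVar) (hN : 0 < N)
    (hP : ∀ p ∈ P, 2 ≤ p.length ∧ p.length ≤ N) (hg : ∀ i, g i ∈ trieVars N P) :
    projectedSolutions g (trieSystem N P)
      = convexHull ℝ (Set.range fun q : Bool × (ℕ → Bool) => triePoint q.1 q.2 ∘ g) := by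
  apply Set.Subset.antisymm
  · rintro z ⟨w, hw, hsys⟩
    have h := holds_trieSystem_iff.mp hsys
    have hF := h.isTrieFlow
    have hI : ∀ σ a, σ :: a ∈ innerNodes P → a ∈ innerNodes P :=
      fun _ _ => mem_innerNodes_of_cons
    have hz : z = ∑ q ∈ (Finset.univ : Finset Bool) ×ˢ words N,
        wordWeight (innerNodes P) (fun i => w (.node (i + 1))) (nodeFlow w) q.1 q.2
          • (triePoint q.1 (bits q.2) ∘ g) := by
      funext i
      rw [← hw i, h.eq_sum_triePoint hN hP (hg i)]
      simp [Finset.sum_apply]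
    rw [hz]
    refine (convex_convexHull ℝ _).sum_mem ?_ ?_ ?_
    · rintro ⟨c, a⟩ hq
      have ha := mem_words.mp (Finset.mem_product.mp hq).2
      exact hF.wordWeight_nonneg nil_mem_innerNodes c a ha.le
    · rw [Finset.sum_product, Fintype.sum_bool, ← Finset.sum_add_distrib]
      exact hF.sum_wordWeight_eq_one hI N
    · rintro ⟨c, a⟩ -
      exact subset_convexHull ℝ _ ⟨(c, bits a), rfl⟩
  · refine convexHull_min ?_ (convex_projectedSolutions _ _)
    rintro _ ⟨⟨c, f⟩, rfl⟩
    exact ⟨triePoint c f, fun i => rfl,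
      holds_trieSystem_iff.mpr (isTrieSolution_triePoint N P c f)⟩

end Integrality

/-! ### Pointed signed hypergraphs -/

theorem mem_iff_lt_card_of_initial {V : Type*} [DecidableEq V] {n : ℕ} (e : V ≃ Fin n)
    (s : Finset V) (hs : ∀ a ∈ s, ∀ b, e b ≤ e a → b ∈ s) (u : V) : u ∈ s ↔ (e u).val < s.card := by
  rw [← Finset.card_map e.toEmbedding]
  constructor
  · intro hu
    have : Finset.Iic (e u) ⊆ s.map e.toEmbedding := by
      intro i hi
      refine Finset.mem_map.mpr ⟨e.symm i, hs u hu _ ?_, by simp⟩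
      simpa using hi
    have := Finset.card_le_card this
    rw [Fin.card_Iic] at this
    omega
  · intro hlt
    by_contra hu
    have : s.map e.toEmbedding ⊆ Finset.Iio (e u) := by
      intro i hi
      obtain ⟨a, ha, rfl⟩ := Finset.mem_map.mp hi
      refine Finset.mem_Iio.mpr (lt_of_not_ge fun hle => hu (hs a ha u hle))
    have := Finset.card_le_card this
    rw [Fin.card_Iio] at this
    omega

section Order

variable {V : Type*} [Fintype V] [DecidableEq V]

/-- The edges at a `β`-leaf `v` are initial segments of a suitable order of the nodes that starts
with `v`: sort by the number of edges at `v` that a node misses. -/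
theorem IsBetaLeaf.exists_order {E : Finset (Finset V)} {v : V}
    (h : IsBetaLeaf (E : Set (Finset V)) v) :
    ∃ e : V ≃ Fin (Fintype.card V), (e v).val = 0 ∧
      ∀ s ∈ E, v ∈ s → ∀ a ∈ s, ∀ b, e b ≤ e a → b ∈ s := by
  let missed : V → Finset (Finset V) := fun w => E.filter (fun s => v ∈ s ∧ w ∉ s)
  let f : V → ℕ := fun w => if w = v then 0 else (missed w).card + 1
  let e₀ := Fintype.equivFin V
  let e : V ≃ Fin (Fintype.card V) := e₀.trans (Tuple.sort (f ∘ e₀.symm)).symm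
  have hmono : ∀ {a b}, e b ≤ e a → f b ≤ f a := by
    intro a b hba
    have := Tuple.monotone_sort (f ∘ e₀.symm) hba
    simpa [e] using this
  refine ⟨e, ?_, ?_⟩
  · have hpos : 0 < Fintype.card V := Fintype.card_pos_iff.mpr ⟨v⟩
    have h0 : e (e.symm ⟨0, hpos⟩) ≤ e v := by
      rw [Equiv.apply_symm_apply]
      exact Nat.zero_le _
    have h1 := hmono h0
    have h2 : e.symm ⟨0, hpos⟩ = v := by
      by_contra hne
      simp [f, hne] at h1
    rw [← h2, Equiv.apply_symm_apply]
  · intro s hs hvs a ha b hba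
    by_contra hb
    have hbv : b ≠ v := by
      rintro rfl
      exact hb hvs
    have h1 := hmono hba
    have hav : a ≠ v := by
      rintro rfl
      simp [f, hbv] at h1
    simp only [f, hbv, hav, if_false, add_le_add_iff_right] at h1
    -- the edges at `v` that miss `a ∈ s` lie inside `s`, so they miss `b ∉ s` too, as does `s`
    refine absurd h1 (not_le.mpr (Finset.card_lt_card ?_))
    rw [Finset.ssubset_iff_of_subset]
    · exact ⟨s, by simp [missed, hs, hvs, hb], by simp [missed, ha]⟩
    · intro t ht
      obtain ⟨htE, hvt, hat⟩ := Finset.mem_filter.mp ht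
      refine Finset.mem_filter.mpr ⟨htE, hvt, fun hbt => ?_⟩
      rcases h.total (show t ∈ {s | s ∈ (E : Set _) ∧ v ∈ s} from ⟨htE, hvt⟩)
        (show s ∈ {s | s ∈ (E : Set _) ∧ v ∈ s} from ⟨hs, hvs⟩) with hts | hst
      · exact hb (hts hbt)
      · exact hat (hst ha)

end Order

section SignBits

variable {V : Type*} [DecidableEq V]

/-- The value of `u` for which its literal in `s` is `1`; `false` for nodes outside of `s`. -/
def SignedEdge.signBit (s : SignedEdge V) (u : V) : Bool :=
  if h : u ∈ s.edge then decide (s.sign ⟨u, h⟩ = 1) else false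

theorem SignedEdge.eq_of_signBit {s t : SignedEdge V} (he : s.edge = t.edge)
    (hb : ∀ u ∈ t.edge, s.signBit u = t.signBit u) : s = t := by
  obtain ⟨e, h2, σ⟩ := s
  obtain ⟨e', h2', τ⟩ := t
  obtain rfl : e = e' := he
  congr 1
  funext ⟨u, hu⟩
  have := hb u hu
  simp only [SignedEdge.signBit, hu, dif_pos, decide_eq_decide] at this
  rcases Int.units_eq_one_or (σ ⟨u, hu⟩) with h | h <;>
    rcases Int.units_eq_one_or (τ ⟨u, hu⟩) with h' | h' <;> simp_all

theorem SignedEdge.signBit_remove (s : SignedEdge V) {u v : V} (h : 3 ≤ s.edge.card)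
    (huv : u ≠ v) : (s.remove v h).signBit u = s.signBit u := by
  by_cases hu : u ∈ s.edge
  · have hu' : u ∈ (s.remove v h).edge := Finset.mem_erase.mpr ⟨huv, hu⟩
    rw [signBit, signBit, dif_pos hu, dif_pos hu']
    rfl
  · simp [signBit, remove, hu]

theorem SignedEdge.prod_literal (s : SignedEdge V) (z : V → ℝ) (β : V → Bool)
    (hz : ∀ u, z u = if β u = true then 1 else 0) :
    ∏ u : {u : V // u ∈ s.edge}, literal (s.sign u) (z u.1)
      = if ∀ u ∈ s.edge, β u = s.signBit u then 1 else 0 := by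
  have h : ∀ u : {u : V // u ∈ s.edge}, literal (s.sign u) (z u.1)
      = if β u.1 = s.signBit u.1 then 1 else 0 := by
    intro u
    simp only [literal, hz, SignedEdge.signBit, u.2, dif_pos]
    by_cases h1 : s.sign u = 1 <;> cases β u.1 <;> simp [h1]
  simp only [h]
  rw [Finset.prod_ite_zero]
  simp

end SignBits

namespace SignedHypergraph

section LaterBits

variable {V : Type*} [Fintype V] {v : V} {e : V ≃ Fin (Fintype.card V)}

/-- The bits of `β` in the order `e`, without the bit of the node in position `0`, continued
by `false`. -/
def laterBits (e : V ≃ Fin (Fintype.card V)) (β : V → Bool) (i : ℕ) : Bool :=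
  if h : i + 1 < Fintype.card V then β (e.symm ⟨i + 1, h⟩) else false

theorem laterBits_sub_one (β : V → Bool) (hev : (e v).val = 0) {u : V} (hu : u ≠ v) :
    laterBits e β ((e u).val - 1) = β u := by
  have h0 : (e u).val ≠ 0 := fun h => hu (e.injective (Fin.ext (h.trans hev.symm)))
  have h1 : (e u).val - 1 + 1 = (e u).val := by omega
  simp [laterBits, h1]

end LaterBits

variable {V : Type*} [Fintype V] [DecidableEq V] {H : SignedHypergraph V} {v : V}
  {e : V ≃ Fin (Fintype.card V)}

/-- The signs of `s`, without the one of `v`, as a word in the order `e`. -/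
def pattern (e : V ≃ Fin (Fintype.card V)) (v : V) (s : SignedEdge V) : List Bool :=
  word (laterBits e s.signBit) (s.edge.erase v).card

@[simp] theorem length_pattern (s : SignedEdge V) :
    (pattern e v s).length = (s.edge.erase v).card := length_word _ _

theorem card_erase_le (s : SignedEdge V) : (s.edge.erase v).card ≤ Fintype.card V - 1 := by
  rw [← Finset.card_univ, ← Finset.card_erase_of_mem (Finset.mem_univ v)]
  exact Finset.card_le_card (Finset.erase_subset_erase _ (Finset.subset_univ _))

/-- The order `e` starts with `v`, and all edges of `H` are initial segments of it, up to `v`. -/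
structure IsAdapted (H : SignedHypergraph V) (v : V) (e : V ≃ Fin (Fintype.card V)) : Prop where
  apply_eq_zero : (e v).val = 0
  mem_iff : ∀ s ∈ H.edges, ∀ u, u ≠ v → (u ∈ s.edge ↔ (e u).val ≤ (s.edge.erase v).card)

theorem IsPointedAt.exists_isAdapted (h : H.IsPointedAt v) : ∃ e, H.IsAdapted v e := by
  classical
  obtain ⟨hleaf, -, hS⟩ := h
  have hE : H.underlyingEdges = ((H.edges.image SignedEdge.edge : Finset (Finset V)) : Set _) := by
    ext t
    simp [underlyingEdges]
  rw [hE] at hleaf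
  obtain ⟨e, hev, he⟩ := hleaf.exists_order
  have hstar : ∀ s ∈ H.star v, ∀ u, u ≠ v →
      (u ∈ s.edge ↔ (e u).val ≤ (s.edge.erase v).card) := by
    rintro s ⟨hs, hvs⟩ u -
    rw [mem_iff_lt_card_of_initial e s.edge (he _ (Finset.mem_image_of_mem _ hs) hvs),
      ← Finset.card_erase_add_one hvs, Nat.lt_succ_iff]
  refine ⟨e, hev, fun s hs u hu => ?_⟩
  have hs' : s ∈ H.star v ∪ H.reducedStar v := hS ▸ hs
  rcases hs' with hs' | ⟨t, ht, h3, rfl⟩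
  · exact hstar s hs' u hu
  · have := hstar t ht u hu
    simpa [SignedEdge.remove, hu] using this

theorem IsAdapted.word_eq_pattern_iff (he : H.IsAdapted v e) {s : SignedEdge V}
    (hs : s ∈ H.edges) {f : ℕ → Bool} {β : V → Bool}
    (hf : ∀ u, u ≠ v → f ((e u).val - 1) = β u) :
    word f (pattern e v s).length = pattern e v s
      ↔ ∀ u ∈ s.edge, u ≠ v → β u = s.signBit u := by
  rw [length_pattern, pattern, word_eq_word_iff]
  constructor
  · intro h u hus hu
    have h0 : (e u).val ≠ 0 := fun h =>
      hu (e.injective (Fin.ext (h.trans he.apply_eq_zero.symm)))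
    have h1 := (he.mem_iff s hs u hu).mp hus
    have h2 := h ((e u).val - 1) (by omega)
    rwa [hf u hu, laterBits_sub_one _ he.apply_eq_zero hu] at h2
  · intro h j hj
    have hlt : j + 1 < Fintype.card V := by
      have := card_erase_le (v := v) s
      omega
    have hu : e.symm ⟨j + 1, hlt⟩ ≠ v := by
      intro huv
      have := he.apply_eq_zero
      rw [← huv] at this
      simp at this
    have hus : e.symm ⟨j + 1, hlt⟩ ∈ s.edge := by
      rw [he.mem_iff s hs _ hu]
      simpa using hj
    have h1 := hf _ hu
    have h2 := laterBits_sub_one s.signBit he.apply_eq_zero hu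
    simp only [Equiv.apply_symm_apply, Nat.add_sub_cancel] at h1 h2
    rw [h1, h2, h _ hus hu]

/-- The variable of a signed edge: a signed edge at `v` is the flow that reaches its pattern with
the value at `v` that the sign of `v` asks for. -/
def edgeVar (e : V ≃ Fin (Fintype.card V)) (v : V) (s : SignedEdge V) : TrieVar :=
  if v ∈ s.edge then .flow (pattern e v s) (s.signBit v) else .edge (pattern e v s)

/-- The variable of a coordinate of the pseudo-Boolean polytope. -/
def coordVar (H : SignedHypergraph V) (v : V) (e : V ≃ Fin (Fintype.card V)) :
    H.Coord → TrieVar :=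
  Sum.elim (fun u => .node (e u).val) (fun s => edgeVar e v s.1)

theorem IsAdapted.edgeVar_injOn (he : H.IsAdapted v e) {s t : SignedEdge V} (hs : s ∈ H.edges)
    (ht : t ∈ H.edges) (h : edgeVar e v s = edgeVar e v t) : s = t := by
  have key : (v ∈ s.edge ↔ v ∈ t.edge) ∧ pattern e v s = pattern e v t ∧
      (v ∈ t.edge → s.signBit v = t.signBit v) := by
    unfold edgeVar at h
    split_ifs at h with h1 h2 h2 <;> simp_all
  obtain ⟨hv, hp, hb⟩ := key
  have hcard : (s.edge.erase v).card = (t.edge.erase v).card := by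
    rw [← length_pattern (e := e), hp, length_pattern]
  refine SignedEdge.eq_of_signBit ?_ ?_
  · ext u
    by_cases hu : u = v
    · rw [hu, hv]
    · rw [he.mem_iff s hs u hu, he.mem_iff t ht u hu, hcard]
  · intro u hut
    by_cases hu : u = v
    · rw [hu] at hut ⊢
      exact hb hut
    · refine (he.word_eq_pattern_iff ht (f := laterBits e s.signBit)
        (fun u hu => laterBits_sub_one _ he.apply_eq_zero hu)).mp ?_ u hut hu
      rw [length_pattern, ← hcard]
      exact hp

theorem IsAdapted.coordVar_injective (he : H.IsAdapted v e) :
    Function.Injective (H.coordVar v e) := by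
  refine Function.Injective.sumElim ?_ ?_ ?_
  · intro u u' h
    exact e.injective (Fin.ext (by simpa using h))
  · intro s t h
    exact Subtype.ext (he.edgeVar_injOn s.2 t.2 h)
  · intro u s
    unfold edgeVar
    split_ifs <;> simp

theorem IsAdapted.triePoint_node (he : H.IsAdapted v e) {f : ℕ → Bool} {β : V → Bool}
    (hf : ∀ u, u ≠ v → f ((e u).val - 1) = β u) (u : V) :
    triePoint (β v) f (.node (e u).val) = if β u = true then 1 else 0 := by
  by_cases hu : u = v
  · rw [hu, he.apply_eq_zero]
    rfl
  · have h0 : (e u).val ≠ 0 := fun h =>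
      hu (e.injective (Fin.ext (h.trans he.apply_eq_zero.symm)))
    obtain ⟨i, hi⟩ := Nat.exists_eq_succ_of_ne_zero h0
    rw [← hf u hu, hi]
    rfl

theorem IsAdapted.triePoint_edgeVar (he : H.IsAdapted v e) {f : ℕ → Bool} {β : V → Bool}
    (hf : ∀ u, u ≠ v → f ((e u).val - 1) = β u) {s : SignedEdge V} (hs : s ∈ H.edges) :
    triePoint (β v) f (edgeVar e v s)
      = if ∀ u ∈ s.edge, β u = s.signBit u then 1 else 0 := by
  have h := he.word_eq_pattern_iff hs hf
  unfold edgeVar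
  by_cases hv : v ∈ s.edge
  · have : (∀ u ∈ s.edge, β u = s.signBit u) ↔
        s.signBit v = β v ∧ ∀ u ∈ s.edge, u ≠ v → β u = s.signBit u := by
      constructor
      · exact fun h => ⟨(h v hv).symm, fun u hu _ => h u hu⟩
      · rintro ⟨h1, h2⟩ u hu
        by_cases huv : u = v
        · rw [huv, h1]
        · exact h2 u hu huv
    simp only [hv, if_true, triePoint, h, this, ite_and]
  · have : (∀ u ∈ s.edge, β u = s.signBit u) ↔ ∀ u ∈ s.edge, u ≠ v → β u = s.signBit u := by
      refine forall₂_congr fun u hu => ?_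
      have : u ≠ v := by
        rintro rfl
        exact hv hu
      simp [this]
    simp only [hv, if_false, triePoint, h, this]

/-- The projections of the integral points of the trie form the pseudo-Boolean set. -/
theorem IsAdapted.range_triePoint (he : H.IsAdapted v e) :
    Set.range (fun q : Bool × (ℕ → Bool) => triePoint q.1 q.2 ∘ H.coordVar v e)
      = H.pseudoBooleanSet := by
  ext z
  constructor
  · rintro ⟨⟨c, f⟩, rfl⟩
    let β : V → Bool := fun u => if u = v then c else f ((e u).val - 1)
    have hf : ∀ u, u ≠ v → f ((e u).val - 1) = β u := fun u hu => by simp [β, hu]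
    have hc : c = β v := by simp [β]
    have hnode := he.triePoint_node hf
    rw [hc]
    refine ⟨?_, fun s => ?_⟩
    · rintro (u | s)
      · have := hnode u
        simp only [Function.comp, coordVar, Sum.elim_inl, this]
        split_ifs <;> simp
      · have := he.triePoint_edgeVar hf s.2
        simp only [Function.comp, coordVar, Sum.elim_inr, this]
        split_ifs <;> simp
    · have h1 := s.1.prod_literal _ β hnode
      refine (he.triePoint_edgeVar hf s.2).trans (Eq.trans ?_ h1.symm)
      congr
  · rintro ⟨h01, hprod⟩
    let β : V → Bool := fun u => decide (z (Sum.inl u) = 1)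
    have hz : ∀ u, z (Sum.inl u) = if β u = true then 1 else 0 := by
      intro u
      rcases h01 (Sum.inl u) with h | h <;> simp [β, h]
    have hf : ∀ u, u ≠ v → laterBits e β ((e u).val - 1) = β u :=
      fun u hu => laterBits_sub_one _ he.apply_eq_zero hu
    refine ⟨(β v, laterBits e β), ?_⟩
    funext i
    rcases i with u | s
    · rw [hz u]
      exact he.triePoint_node hf u
    · rw [hprod s, s.1.prod_literal (fun u => z (Sum.inl u)) β hz]
      refine (he.triePoint_edgeVar hf s.2).trans ?_
      congr

/-- The patterns of the signed edges that avoid `v`. -/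
def patterns (H : SignedHypergraph V) (v : V) (e : V ≃ Fin (Fintype.card V)) :
    Finset (List Bool) :=
  (H.edges.filter (fun s => v ∉ s.edge)).image (pattern e v)

theorem length_of_mem_patterns {p : List Bool} (hp : p ∈ H.patterns v e) :
    2 ≤ p.length ∧ p.length ≤ Fintype.card V - 1 := by
  obtain ⟨s, hs, rfl⟩ := Finset.mem_image.mp hp
  rw [length_pattern]
  refine ⟨?_, card_erase_le s⟩
  rw [Finset.erase_eq_of_notMem (Finset.mem_filter.mp hs).2]
  exact s.two_le_card

theorem IsAdapted.pattern_remove (he : H.IsAdapted v e) (s : SignedEdge V)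
    (h3 : 3 ≤ s.edge.card) : pattern e v (s.remove v h3) = pattern e v s := by
  have hcard : ((s.remove v h3).edge.erase v).card = (s.edge.erase v).card := by
    simp [SignedEdge.remove]
  rw [pattern, pattern, hcard, word_eq_word_iff]
  intro j _
  unfold laterBits
  split_ifs with hj
  · refine s.signBit_remove h3 fun huv => ?_
    have := he.apply_eq_zero
    rw [← huv] at this
    simp at this
  · rfl

theorem IsPointedAt.coordVar_mem_trieVars (h : H.IsPointedAt v) (he : H.IsAdapted v e)
    (i : H.Coord) : H.coordVar v e i ∈ trieVars (Fintype.card V - 1) (H.patterns v e) := by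
  rcases i with u | ⟨s, hs⟩
  · have := (e u).isLt
    simp only [coordVar, Sum.elim_inl, node_mem_trieVars]
    omega
  · simp only [coordVar, Sum.elim_inr, edgeVar]
    split_ifs with hv
    · have hlen : (pattern e v s).length + 1 = s.edge.card := by
        rw [length_pattern, Finset.card_erase_add_one hv]
      have h2 := s.two_le_card
      obtain ⟨σ, a, ha⟩ := List.exists_cons_of_ne_nil
        (show pattern e v s ≠ [] by intro h0; simp [h0] at hlen; omega)
      rw [ha, flow_cons_mem_trieVars]
      by_cases h3 : 3 ≤ s.edge.card
      · refine mem_innerNodes_of_cons_mem (σ := σ) ?_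
        rw [← ha, ← he.pattern_remove s h3]
        refine Finset.mem_image_of_mem _ (Finset.mem_filter.mpr ⟨?_, ?_⟩)
        · have : s.remove v h3 ∈ (H.edges : Set (SignedEdge V)) := by
            rw [h.2.2]
            exact Or.inr ⟨s, ⟨hs, hv⟩, h3, rfl⟩
          exact this
        · simp [SignedEdge.remove]
      · rw [ha] at hlen
        have : a = [] := List.eq_nil_of_length_eq_zero (by simp at hlen; omega)
        rw [this]
        exact nil_mem_innerNodes
    · exact edge_mem_trieVars.mpr
        (Finset.mem_image_of_mem _ (Finset.mem_filter.mpr ⟨hs, hv⟩))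

/-- Deleting `v` maps the signed edges at `v` onto the others, so the latter are at most half of
all signed edges. -/
theorem IsPointedAt.two_mul_card_patterns_le (h : H.IsPointedAt v) :
    2 * (H.patterns v e).card ≤ H.edges.card := by
  have h1 : (H.edges.filter (fun s => v ∉ s.edge)).card
      ≤ (H.edges.filter (fun s => v ∈ s.edge)).card := by
    refine Finset.card_le_card_of_surjOn
      (fun s => if h3 : 3 ≤ s.edge.card then s.remove v h3 else s) ?_
    intro t ht
    obtain ⟨htH, hvt⟩ := Finset.mem_filter.mp ht
    have ht' : t ∈ H.star v ∪ H.reducedStar v := h.2.2 ▸ htH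
    rcases ht' with ht' | ⟨s, hs, h3, rfl⟩
    · exact absurd ht'.2 hvt
    · exact ⟨s, Finset.mem_filter.mpr hs, by simp [h3]⟩
  have h2 := Finset.card_filter_add_card_filter_not (s := H.edges) (fun s => v ∈ s.edge)
  have h3 : (H.patterns v e).card ≤ _ := Finset.card_image_le
  omega

theorem IsPointedAt.two_le_card (h : H.IsPointedAt v) : 2 ≤ Fintype.card V := by
  obtain ⟨-, ⟨s, -, -, hs⟩, -⟩ := h
  rw [← Finset.card_univ, ← hs]
  exact s.two_le_card

theorem IsPointedAt.one_le_card_edges (h : H.IsPointedAt v) : 1 ≤ H.edges.card := by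
  obtain ⟨-, ⟨s, hs, -⟩, -⟩ := h
  exact Finset.card_pos.mpr ⟨s, hs.1⟩

end SignedHypergraph

theorem mainTheorem3 {V : Type*} [Fintype V] [DecidableEq V] (H : SignedHypergraph V)
    (hH : H.IsPointed) :
    ∃ (m k : ℕ) (A : Matrix (Fin m) (H.Coord ⊕ Fin k) ℝ) (b : Fin m → ℝ),
      IsExtendedFormulation H.pseudoBooleanPolytope A b ∧
      Fintype.card V + H.edges.card + k ≤ 2 * Fintype.card V * (H.edges.card + 1) ∧
      (m : ℤ) ≤ 4 * ((H.edges.card : ℤ) * ((Fintype.card V : ℤ) - 2) + (Fintype.card V : ℤ)) ∧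
      (∀ i j, A i j = 0 ∨ A i j = 1 ∨ A i j = -1) ∧
      (∀ i, b i = 0 ∨ b i = 1 ∨ b i = -1) := by
  obtain ⟨v, hv⟩ := hH
  obtain ⟨e, he⟩ := hv.exists_isAdapted
  have hn := hv.two_le_card
  have hm := hv.one_le_card_edges
  have h2P := hv.two_mul_card_patterns_le (e := e)
  set P := H.patterns v e with hPdef
  have hP : ∀ p ∈ P, 2 ≤ p.length ∧ p.length ≤ Fintype.card V - 1 :=
    fun p hp => SignedHypergraph.length_of_mem_patterns hp
  have hN : 0 < Fintype.card V - 1 := by omega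
  obtain ⟨k, A, b, hEF, hk, hA, hb⟩ := exists_isExtendedFormulation (H.coordVar v e)
    he.coordVar_injective (trieVars (Fintype.card V - 1) P) (hv.coordVar_mem_trieVars he)
    (trieSystem (Fintype.card V - 1) P) (trieSystem_subset_trieVars hN fun p hp => (hP p hp).1)
  rw [projectedSolutions_trieSystem _ hN hP (hv.coordVar_mem_trieVars he),
    he.range_triePoint] at hEF
  have hI := card_innerNodes_le fun p hp => (hP p hp).2
  have hvars := card_trieVars_le (N := Fintype.card V - 1) (P := P)
  have hrows := card_trieSystem_le (Fintype.card V - 1) P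
  rw [← hk, Fintype.card_sum, Fintype.card_coe] at hvars
  obtain ⟨r, hr⟩ := Nat.exists_eq_add_of_le' hn
  rw [hr] at hI hvars hrows hP ⊢
  simp only [Nat.add_sub_cancel, show r + 2 - 1 = r + 1 by omega] at hI hvars hrows hP
  -- for `|V| = 2` there are no patterns, which is needed to meet the bound exactly
  have hr0 : P.card ≤ P.card * r + r := by
    rcases Nat.eq_zero_or_pos r with h0 | h0
    · have : P = ∅ := Finset.eq_empty_of_forall_notMem fun p hp => by
        have := hP p hp
        omega
      simp [this]
    · exact (Nat.le_mul_of_pos_right _ h0).trans (Nat.le_add_right _ _)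
  have hmr : 2 * (P.card * r) ≤ H.edges.card * r := by
    rw [← mul_assoc]
    exact Nat.mul_le_mul_right _ h2P
  refine ⟨_, k, A, b, hEF, ?_, ?_, hA, hb⟩
  · nlinarith
  · have h : (trieSystem (r + 1) P).card ≤ 4 * (H.edges.card * r + (r + 2)) := by omega
    have h' : ((trieSystem (r + 1) P).card : ℤ) ≤ ((4 * (H.edges.card * r + (r + 2)) : ℕ) : ℤ) :=
      Int.ofNat_le.mpr h
    push_cast at h' ⊢
    simpa [hr] using h'
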